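/- Let $\mathcal L$ be a closed subspace of the real Hilbert space $L^2[0,1]$ and let $F:\mathcal L\times\mathcal L\to\mathbb R$ be a nonzero bounded bilinear map. For an $m\times n$ real matrix $H$, controls $u_1,\dots,u_m,v_1,\dots,v_n\in\mathcal L$ *realize* $H$ if $F(u_i,v_j)=H_{ij}$ for all $i,j$; their cost is $$I(\mathcal U,\mathcal V)=\frac1m\sum_{i=1}^m\int_0^1u_i(t)^2\,dt+\frac1n\sum_{j=1}^n\int_0^1v_j(t)^2\,dt .$$ Let $\hat C_F(H)\in[0,\infty]$ be the infimum of $I(\mathcal U,\mathcal V)$ over all controls that realize $H$ (it is $\infty$ if there are none). Let $(e_i)$ and $(f_j)$ be orthonormal bases of $\mathcal L$, finite or indexed by the positive integers, and let $\mathbf F=[F(e_i,f_j)]$ be the matrix that represents $F$; write $\mathbf F_l$ for its upper left $l\times l$ corner. Suppose that $\mathbf F$ is *regular*: $\mathbf F_l$ is nonsingular for every positive integer $l$ that is at most the rank of $\mathbf F$. Let $\sigma_1(\mathbf F)$ be the largest singular value of $\mathbf F$ if $\mathbf F$ is finite, and the limit as $l\to\infty$ of the largest singular value of $\mathbf F_l$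 if $\mathbf F$ is infinite. A *sub-matrix partition* of an $m\times n$ real matrix $H$ ($m,n\ge1$) is a family $\{H_1,\dots,H_K\}$ of sub-matrices, where $H_k$ is the $m_k\times n_k$ sub-matrix of $H$ with rows in a set $\mathcal M_k\subset\{1,\dots,m\}$ and columns in a set $\mathcal N_k\subset\{1,\dots,n\}$, such that every position $(i,j)$ lies in $\mathcal M_k\times\mathcal N_k$ for exactly one $k$. **Theorem.** For every sub-matrix partition $\{H_1,\dots,H_K\}$ of $H$, $$A=\frac1{mn}\sum_{k=1}^Km_kn_k\,\hat C_F(H_k)\ \ge\ \frac{2}{mn\,\sigma_1(\mathbf F)}\sum_{i=1}^m\sum_{j=1}^n|H_{ij}| .$$ If every $H_k$ is monochromatic, meaning that all entries of $H_k$ are equal, then this bound is the infimum value of the averaged cost: $A$ is equal to the right-hand side, which is also the infimum (in particular, the set is non-empty) of the averages $\frac1{mn}\sum_km_kn_k\,I(\mathcal U_k,\mathcal V_k)$ over all choices, for each $k$, of controls $(\mathcal U_k,\mathcal V_k)$ in $\mathcal L$ that realize $H_k$. -/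

import Mathlib

open MeasureTheory Filter Topology
open scoped ENNReal

namespace DistributedControl

/-- The real Hilbert space `L²[0,1]` of square integrable control functions. -/
abbrev ControlSpace : Type :=
  Lp ℝ 2 (volume.restrict (Set.Icc (0 : ℝ) 1))

/-! ### Single round protocols and their cost -/

/-- The control energy `∫₀¹ w(t)² dt` of a control function. -/
noncomputable def energy (w : ControlSpace) : ℝ :=
  ∫ t in Set.Icc (0 : ℝ) 1, (w t) ^ 2

section Cost

variable {𝓛 : Submodule ℝ ControlSpace}

/-- The controls `u₁, …, uₘ` of Alice and `v₁, …, vₙ` of Bob, taken in `𝓛`, realize the target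
matrix `H` in a single round: `F(uᵢ, vⱼ) = Hᵢⱼ` for all `i, j`. -/
def Realizes (F : 𝓛 →L[ℝ] 𝓛 →L[ℝ] ℝ) {m n : ℕ} (H : Matrix (Fin m) (Fin n) ℝ)
    (u : Fin m → 𝓛) (v : Fin n → 𝓛) : Prop :=
  ∀ i j, F (u i) (v j) = H i j

/-- The cost `I(𝒰, 𝒱) = (1/m) ∑ᵢ ∫₀¹ uᵢ² dt + (1/n) ∑ⱼ ∫₀¹ vⱼ² dt` of a single round protocol. -/
noncomputable def protocolCost {m n : ℕ} (u : Fin m → 𝓛) (v : Fin n → 𝓛) : ℝ :=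
  (1 / (m : ℝ)) * ∑ i, energy (u i) + (1 / (n : ℝ)) * ∑ j, energy (v j)

/-- The infimum cost `Ĉ_F(H)` of the single round protocols that realize `H`. It is extended-valued:
it is `∞`, the infimum of the empty set, if no single round protocol realizes `H`. -/
noncomputable def infCost (F : 𝓛 →L[ℝ] 𝓛 →L[ℝ] ℝ) {m n : ℕ} (H : Matrix (Fin m) (Fin n) ℝ) :
    ℝ≥0∞ :=
  ⨅ (u : Fin m → 𝓛) (v : Fin n → 𝓛) (_ : Realizes F H u v), ENNReal.ofReal (protocolCost u v)

end Cost

/-! ### Matrix representations of a bilinear map -/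

/-- The index set of an ordered basis with `L` elements, `L` finite or countably infinite: the
natural numbers `i < L` (so the indices start from `0`). -/
abbrev BasisIndex (L : ℕ∞) : Type := {i : ℕ // (i : ℕ∞) < L}

/-- The matrix `[F(eᵢ, fⱼ)]` that represents `F` with respect to two orthonormal bases of `𝓛`. -/
noncomputable def matrixRep {𝓛 : Submodule ℝ ControlSpace} (F : 𝓛 →L[ℝ] 𝓛 →L[ℝ] ℝ) {L : ℕ∞}
    (e f : HilbertBasis (BasisIndex L) ℝ 𝓛) : Matrix (BasisIndex L) (BasisIndex L) ℝ :=
  Matrix.of fun i j => F (e i) (f j)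

/-- The `l`-by-`l` upper left corner of a matrix. -/
def leadingMinor {L : ℕ∞} (M : Matrix (BasisIndex L) (BasisIndex L) ℝ) (l : ℕ) (hl : (l : ℕ∞) ≤ L) :
    Matrix (Fin l) (Fin l) ℝ :=
  let c : Fin l → BasisIndex L := fun i => ⟨i, lt_of_lt_of_le (Nat.cast_lt.2 i.isLt) hl⟩
  M.submatrix c c

/-- A matrix representation is regular if its leading `l`-by-`l` corner is nonsingular for every
positive integer `l` that is at most its rank, the number of its independent columns (infinite if no
finite set of columns spans them all). Such an `l` is at most `L`. -/
def IsRegular {L : ℕ∞} (M : Matrix (BasisIndex L) (BasisIndex L) ℝ) : Prop :=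
  ∀ (l : ℕ) (hl : (l : ℕ∞) ≤ L), 0 < l → (l : ℕ∞) ≤ M.eRank → (leadingMinor M l hl).det ≠ 0

/-- The singular values of a finite matrix in decreasing order; `singularValue M 0` is the largest
one. -/
noncomputable def singularValue {p q : ℕ} (M : Matrix (Fin p) (Fin q) ℝ) (i : ℕ) : ℝ :=
  (Matrix.toEuclideanLin M).singularValues i

open Classical in
/-- The singular values of a matrix representation: those of the matrix itself if it is finite, and
the limits of the singular values of its leading `l`-by-`l` corners as `l → ∞` if it is infinite.
`sigma M 0` is the largest one. -/
noncomputable def sigma {L : ℕ∞} (M : Matrix (BasisIndex L) (BasisIndex L) ℝ) (i : ℕ) : ℝ :=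
  if h : L = ⊤ then
    limUnder atTop fun l : ℕ => singularValue (leadingMinor M l (h ▸ le_top)) i
  else
    singularValue (leadingMinor M L.toNat (ENat.natCast_toNat_le_self L)) i

/-! ### Partitions of a matrix into sub-matrices -/

/-- A partition of an `m`-by-`n` matrix into `K` sub-matrices. The `k`-th one has the distinct row
indices `t k 0, t k 1, …` and the distinct column indices `s k 0, s k 1, …`; every position `(i, j)`
of the matrix lies in one of the sub-matrices, and in only one. -/
structure SubmatrixPartition (m n K : ℕ) where
  rows : Fin K → ℕ
  cols : Fin K → ℕ
  t : (k : Fin K) → Fin (rows k) ↪ Fin m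
  s : (k : Fin K) → Fin (cols k) ↪ Fin n
  covers : ∀ i j, ∃ k a b, t k a = i ∧ s k b = j
  disjoint : ∀ k k' a b a' b', t k a = t k' a' → s k b = s k' b' → k = k'

/-- The sub-matrix `H_k`, with entries `H_k(a, b) = H(t_{k,a}, s_{k,b})`. -/
def SubmatrixPartition.block {m n K : ℕ} (P : SubmatrixPartition m n K)
    (H : Matrix (Fin m) (Fin n) ℝ) (k : Fin K) : Matrix (Fin (P.rows k)) (Fin (P.cols k)) ℝ :=
  H.submatrix (P.t k) (P.s k)

/-- All entries of the matrix have the same value. -/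
def IsMonochromatic {p q : ℕ} (M : Matrix (Fin p) (Fin q) ℝ) : Prop :=
  ∀ a b a' b', M a b = M a' b'

section AveragedCost

variable {𝓛 : Submodule ℝ ControlSpace}

/-- The averaged single round cost `A = (1/mn) ∑ₖ mₖ nₖ Ĉ_F(H_k)` of a partition. -/
noncomputable def averagedCost (F : 𝓛 →L[ℝ] 𝓛 →L[ℝ] ℝ) {m n K : ℕ} (H : Matrix (Fin m) (Fin n) ℝ)
    (P : SubmatrixPartition m n K) : ℝ≥0∞ :=
  ((m : ℝ≥0∞) * n)⁻¹ * ∑ k, (P.rows k : ℝ≥0∞) * P.cols k * infCost F (P.block H k)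

/-- The average costs `(1/mn) ∑ₖ mₖ nₖ I(𝒰_k, 𝒱_k)` of all the ways to apply to each sub-matrix
`H_k` a single round protocol `(𝒰_k, 𝒱_k)` that realizes it. -/
def attainableAverages (F : 𝓛 →L[ℝ] 𝓛 →L[ℝ] ℝ) {m n K : ℕ} (H : Matrix (Fin m) (Fin n) ℝ)
    (P : SubmatrixPartition m n K) : Set ℝ :=
  {x | ∃ (u : (k : Fin K) → Fin (P.rows k) → 𝓛) (v : (k : Fin K) → Fin (P.cols k) → 𝓛),
    (∀ k, Realizes F (P.block H k) (u k) (v k)) ∧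
      x = (1 / ((m : ℝ) * n)) * ∑ k, (P.rows k : ℝ) * P.cols k * protocolCost (u k) (v k)}

end AveragedCost

end DistributedControl

/-! The number `σ₁` is the norm of the bilinear form, i.e. the best `C` in `|F u v| ≤ C ‖u‖ ‖v‖`
(`sigma_zero_eq_bilinNorm`): finite corners are restrictions of `F`, so they never exceed the norm,
and they exhaust `F` because projections onto basis vectors converge strongly to the identity.

For a nonempty block, `m n I` equals the sum over positions `(i, j)` of `‖uᵢ‖² + ‖vⱼ‖²`
(`protocolCost_eq`). By AM-GM each term is at least `2 |Hᵢⱼ| / σ₁`. Thus the weights `mₖ nₖ` turn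
the block bounds into sums over entries, which add up over a partition
(`SubmatrixPartition.sum_eq`).

A monochromatic block needs only one pair `(u, v)`, repeated. Taking a pair on which `F` nearly
reaches its norm and balancing the two lengths makes AM-GM nearly sharp
(`exists_apply_eq_norm_sq_add_le`). The norm need not be attained, hence the `ε` throughout. -/

namespace LinearMap

/-! ### The largest singular value as an operator norm -/

variable {E G : Type*} [NormedAddCommGroup E] [InnerProductSpace ℝ E] [FiniteDimensional ℝ E]
  [NormedAddCommGroup G] [InnerProductSpace ℝ G] [FiniteDimensional ℝ G]

/-- In an orthonormal eigenbasis `b` of `T* T`, `‖T x‖²` is the sum of `σᵢ² ⟨bᵢ, x⟩²`, and every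
`σᵢ` is at most `σ₀`. -/
theorem norm_apply_le_singularValues_zero (T : E →ₗ[ℝ] G) (x : E) :
    ‖T x‖ ≤ T.singularValues 0 * ‖x‖ := by
  let b := T.isSymmetric_adjoint_comp_self.eigenvectorBasis rfl
  have hb (i : Fin (Module.finrank ℝ E)) :
      (adjoint T ∘ₗ T) (b i) = (T.singularValues i ^ 2) • b i := by
    have := T.isSymmetric_adjoint_comp_self.apply_eigenvectorBasis rfl i
    rw [T.sq_singularValues_fin rfl i]
    exact this
  refine le_of_sq_le_sq ?_ (mul_nonneg (T.singularValues_nonneg 0) (norm_nonneg x))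
  have h1 : ‖T x‖ ^ 2 = inner ℝ x ((adjoint T ∘ₗ T) x) := by
    rw [← real_inner_self_eq_norm_sq, comp_apply, adjoint_inner_right]
  have h2 (i : Fin (Module.finrank ℝ E)) : inner ℝ (b i) ((adjoint T ∘ₗ T) x)
      = T.singularValues i ^ 2 * inner ℝ (b i) x := by
    rw [← T.isSymmetric_adjoint_comp_self (b i) x, hb, real_inner_smul_left]
  rw [h1, ← b.sum_inner_mul_inner, mul_pow, ← real_inner_self_eq_norm_sq x,
    ← b.sum_inner_mul_inner x x, Finset.mul_sum]
  refine Finset.sum_le_sum fun i _ => ?_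
  rw [h2, real_inner_comm, ← mul_assoc, mul_comm _ (_ ^ 2), mul_assoc]
  exact mul_le_mul_of_nonneg_right
    (pow_le_pow_left₀ (T.singularValues_nonneg _) (T.singularValues_antitone (Nat.zero_le _)) 2)
    (mul_self_nonneg _)

/-- An eigenvector of `T* T` for `σ₀²` is stretched by exactly `σ₀`. -/
theorem singularValues_zero_le_of_norm_apply_le (T : E →ₗ[ℝ] G) {C : ℝ} (hC : 0 ≤ C)
    (h : ∀ x, ‖T x‖ ≤ C * ‖x‖) : T.singularValues 0 ≤ C := by
  rcases Nat.eq_zero_or_pos (Module.finrank ℝ E) with h0 | h0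
  -- On the zero space there is no eigenvector, and `σ₀` is `0` by convention.
  · rwa [T.singularValues_of_finrank_le h0.le]
  obtain ⟨x, hx⟩ := (T.hasEigenvalue_adjoint_comp_self_sq_singularValues h0).exists_hasEigenvector
  have hx0 : 0 < ‖x‖ := norm_pos_iff.2 hx.2
  have h1 : ‖T x‖ ^ 2 = T.singularValues 0 ^ 2 * ‖x‖ ^ 2 := by
    rw [← real_inner_self_eq_norm_sq, ← adjoint_inner_right, ← comp_apply, hx.apply_eq_smul,
      real_inner_smul_right, real_inner_self_eq_norm_sq]
    rfl
  rw [← mul_pow] at h1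
  have h2 := h x
  rw [(sq_eq_sq₀ (norm_nonneg _) (mul_nonneg (T.singularValues_nonneg 0) hx0.le)).1 h1] at h2
  exact le_of_mul_le_mul_right h2 hx0

end LinearMap

namespace DistributedControl

theorem singularValue_nonneg {p q : ℕ} (M : Matrix (Fin p) (Fin q) ℝ) (i : ℕ) :
    0 ≤ singularValue M i :=
  LinearMap.singularValues_nonneg _ _

/-! ### Finite corners as compressions of the form -/

section Compression

variable {E : Type*} [NormedAddCommGroup E] [InnerProductSpace ℝ E]

theorem norm_sum_smul_of_orthonormal {l : ℕ} {a : Fin l → E} (ha : Orthonormal ℝ a)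
    (x : EuclideanSpace ℝ (Fin l)) : ‖∑ i, x i • a i‖ = ‖x‖ := by
  rw [← sq_eq_sq₀ (norm_nonneg _) (norm_nonneg _), ← real_inner_self_eq_norm_sq,
    ha.inner_sum, EuclideanSpace.norm_sq_eq]
  simp [sq]

theorem inner_toEuclideanLin_eq (F : E →L[ℝ] E →L[ℝ] ℝ) {l : ℕ} {a b : Fin l → E}
    {M : Matrix (Fin l) (Fin l) ℝ} (hM : ∀ i j, M i j = F (a i) (b j))
    (x y : EuclideanSpace ℝ (Fin l)) :
    inner ℝ x (Matrix.toEuclideanLin M y) = F (∑ i, x i • a i) (∑ j, y j • b j) := by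
  simp only [PiLp.inner_apply, Matrix.toLpLin_apply, Matrix.mulVec, dotProduct, hM, map_sum,
    map_smul, sum_apply, smul_apply, smul_eq_mul,
    RCLike.inner_apply, conj_trivial, Finset.sum_mul, Finset.mul_sum]
  rw [Finset.sum_comm]
  refine Finset.sum_congr rfl fun i _ => Finset.sum_congr rfl fun j _ => ?_
  ring

theorem exists_abs_apply_le (F : E →L[ℝ] E →L[ℝ] ℝ) :
    ∃ C : ℝ, 0 ≤ C ∧ ∀ u v, |F u v| ≤ C * ‖u‖ * ‖v‖ :=
  ⟨‖F‖, norm_nonneg F, F.le_opNorm₂⟩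

theorem continuous_apply_apply (F : E →L[ℝ] E →L[ℝ] ℝ) : Continuous fun p : E × E => F p.1 p.2 :=
  F.isBoundedBilinearMap.continuous

/-- Pairing `z = M y` with itself turns the bound on `F` into `‖z‖² ≤ C ‖z‖ ‖y‖`. -/
theorem singularValue_zero_le_of_abs_apply_le (F : E →L[ℝ] E →L[ℝ] ℝ) {l : ℕ} {a b : Fin l → E}
    (ha : Orthonormal ℝ a) (hb : Orthonormal ℝ b)
    {M : Matrix (Fin l) (Fin l) ℝ} (hM : ∀ i j, M i j = F (a i) (b j))
    {C : ℝ} (hC : 0 ≤ C) (h : ∀ u v, |F u v| ≤ C * ‖u‖ * ‖v‖) : singularValue M 0 ≤ C := by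
  refine LinearMap.singularValues_zero_le_of_norm_apply_le _ hC fun y => ?_
  set z := Matrix.toEuclideanLin M y with hz
  rcases (norm_nonneg z).eq_or_lt with h0 | h0
  · rw [← h0]; positivity
  refine le_of_mul_le_mul_left ?_ h0
  calc ‖z‖ * ‖z‖ = F (∑ i, z i • a i) (∑ j, y j • b j) := by
        rw [← inner_toEuclideanLin_eq F hM, ← hz, real_inner_self_eq_norm_mul_norm]
    _ ≤ |F (∑ i, z i • a i) (∑ j, y j • b j)| := le_abs_self _
    _ ≤ C * ‖∑ i, z i • a i‖ * ‖∑ j, y j • b j‖ := h _ _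
    _ = ‖z‖ * (C * ‖y‖) := by
        rw [norm_sum_smul_of_orthonormal ha, norm_sum_smul_of_orthonormal hb]; ring

/-- By Bessel, the coordinate vectors of `u` and `v` are no longer than `u` and `v`. -/
theorem abs_apply_projection_le (F : E →L[ℝ] E →L[ℝ] ℝ) {l : ℕ} {a b : Fin l → E}
    (ha : Orthonormal ℝ a) (hb : Orthonormal ℝ b)
    {M : Matrix (Fin l) (Fin l) ℝ} (hM : ∀ i j, M i j = F (a i) (b j)) (u v : E) :
    |F (∑ i, inner ℝ (a i) u • a i) (∑ j, inner ℝ (b j) v • b j)|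
      ≤ singularValue M 0 * ‖u‖ * ‖v‖ := by
  have bessel {c : Fin l → E} (hc : Orthonormal ℝ c) (w : E) :
      ‖WithLp.toLp 2 fun i => inner ℝ (c i) w‖ ≤ ‖w‖ := by
    refine le_of_sq_le_sq ?_ (norm_nonneg w)
    rw [EuclideanSpace.norm_sq_eq]
    exact hc.sum_inner_products_le w (s := Finset.univ)
  have h := inner_toEuclideanLin_eq F hM (WithLp.toLp 2 fun i => inner ℝ (a i) u)
    (WithLp.toLp 2 fun j => inner ℝ (b j) v)
  simp only at h
  rw [← h]
  refine (abs_real_inner_le_norm _ _).trans ?_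
  refine (mul_le_mul (bessel ha u)
    ((LinearMap.norm_apply_le_singularValues_zero _ _).trans
      (mul_le_mul_of_nonneg_left (bessel hb v) (singularValue_nonneg M 0)))
    (norm_nonneg _) (norm_nonneg _)).trans_eq ?_
  rw [singularValue]; ring

end Compression

/-! ### The largest singular value of the representation is the norm of the form -/

section Sigma

variable {𝓛 : Submodule ℝ ControlSpace}

/-- The least constant `C ≥ 0` with `|F u v| ≤ C ‖u‖ ‖v‖` for all `u, v`. -/
noncomputable def bilinNorm (F : 𝓛 →L[ℝ] 𝓛 →L[ℝ] ℝ) : ℝ :=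
  sInf {C : ℝ | 0 ≤ C ∧ ∀ u v, |F u v| ≤ C * ‖u‖ * ‖v‖}

theorem bilinNorm_nonneg (F : 𝓛 →L[ℝ] 𝓛 →L[ℝ] ℝ) : 0 ≤ bilinNorm F :=
  Real.sInf_nonneg fun _ h => h.1

theorem bilinNorm_le (F : 𝓛 →L[ℝ] 𝓛 →L[ℝ] ℝ) {C : ℝ} (hC : 0 ≤ C)
    (h : ∀ u v, |F u v| ≤ C * ‖u‖ * ‖v‖) : bilinNorm F ≤ C :=
  csInf_le ⟨0, fun _ h => h.1⟩ ⟨hC, h⟩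

/-- The infimum is itself admissible: for nonzero `u`, `v` the condition on `C` is a lower bound `|F
u v| / (‖u‖ ‖v‖) ≤ C`. -/
theorem abs_apply_le (F : 𝓛 →L[ℝ] 𝓛 →L[ℝ] ℝ) (u v : 𝓛) :
    |F u v| ≤ bilinNorm F * ‖u‖ * ‖v‖ := by
  rcases eq_or_ne u 0 with rfl | hu
  · simp
  rcases eq_or_ne v 0 with rfl | hv
  · simp
  rw [mul_assoc, ← div_le_iff₀ (by positivity)]
  refine le_csInf (exists_abs_apply_le (E := 𝓛) F) fun C hC => ?_
  rw [div_le_iff₀ (by positivity), ← mul_assoc]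
  exact hC.2 u v

theorem bilinNorm_pos {F : 𝓛 →L[ℝ] 𝓛 →L[ℝ] ℝ} (hF : F ≠ 0) : 0 < bilinNorm F := by
  refine (bilinNorm_nonneg F).lt_of_ne' fun h => hF ?_
  ext u v
  simpa [h] using abs_apply_le F u v

theorem orthonormal_leading {L : ℕ∞} (e : HilbertBasis (BasisIndex L) ℝ 𝓛) (l : ℕ)
    (hl : (l : ℕ∞) ≤ L) : Orthonormal ℝ
      fun i : Fin l => e ⟨i, lt_of_lt_of_le (Nat.cast_lt.2 i.isLt) hl⟩ :=
  e.orthonormal.comp (fun i : Fin l => ⟨i, lt_of_lt_of_le (Nat.cast_lt.2 i.isLt) hl⟩)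
    fun _ _ h => Fin.ext (congrArg Subtype.val h)

theorem singularValue_leadingMinor_le (F : 𝓛 →L[ℝ] 𝓛 →L[ℝ] ℝ) {L : ℕ∞}
    (e f : HilbertBasis (BasisIndex L) ℝ 𝓛) (l : ℕ) (hl : (l : ℕ∞) ≤ L) :
    singularValue (leadingMinor (matrixRep F e f) l hl) 0 ≤ bilinNorm F :=
  singularValue_zero_le_of_abs_apply_le (E := 𝓛) F (orthonormal_leading e l hl) (orthonormal_leading f l hl)
    (fun _ _ => rfl) (bilinNorm_nonneg F) (abs_apply_le F)

theorem singularValue_leadingMinor_eq_norm (F : 𝓛 →L[ℝ] 𝓛 →L[ℝ] ℝ) {L : ℕ∞}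
    (e f : HilbertBasis (BasisIndex L) ℝ 𝓛) (l : ℕ) (hl : (l : ℕ∞) ≤ L) (hL : L ≤ l) :
    singularValue (leadingMinor (matrixRep F e f) l hl) 0 = bilinNorm F := by
  refine le_antisymm (singularValue_leadingMinor_le F e f l hl)
    (bilinNorm_le F (singularValue_nonneg _ _) fun u v => ?_)
  let φ : Fin l ≃ BasisIndex L :=
    { toFun := fun i => ⟨i, lt_of_lt_of_le (Nat.cast_lt.2 i.isLt) hl⟩
      invFun := fun i => ⟨i, Nat.cast_lt.1 (i.2.trans_le hL)⟩
      left_inv := fun _ => rfl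
      right_inv := fun _ => rfl }
  have expand (b : HilbertBasis (BasisIndex L) ℝ 𝓛) (w : 𝓛) :
      ∑ i : Fin l, inner ℝ (b (φ i)) w • b (φ i) = w := by
    have := (φ.hasSum_iff.2 (b.hasSum_repr w)).unique (hasSum_fintype _)
    simpa [b.repr_apply_apply] using this.symm
  have h := abs_apply_projection_le (E := 𝓛) F (orthonormal_leading e l hl) (orthonormal_leading f l hl)
    (M := leadingMinor (matrixRep F e f) l hl) (fun _ _ => rfl) u v
  have hu := expand e u
  have hv := expand f v
  simp only [φ, Equiv.coe_fn_mk] at hu hv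
  rw [hu, hv] at h
  exact h

theorem tendsto_singularValue_leadingMinor (F : 𝓛 →L[ℝ] 𝓛 →L[ℝ] ℝ)
    (e f : HilbertBasis (BasisIndex ⊤) ℝ 𝓛) :
    Tendsto (fun l : ℕ => singularValue (leadingMinor (matrixRep F e f) l le_top) 0) atTop
      (𝓝 (bilinNorm F)) := by
  let φ : ℕ ≃ BasisIndex ⊤ :=
    { toFun := fun i => ⟨i, ENat.natCast_lt_top i⟩
      invFun := fun i => i
      left_inv := fun _ => rfl
      right_inv := fun _ => rfl }
  have expand (b : HilbertBasis (BasisIndex ⊤) ℝ 𝓛) (w : 𝓛) : Tendsto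
      (fun l : ℕ => ∑ i : Fin l, inner ℝ (b (φ i)) w • b (φ i)) atTop (𝓝 w) := by
    have := (φ.hasSum_iff.2 (b.hasSum_repr w)).tendsto_sum_nat
    simpa only [Function.comp_apply, b.repr_apply_apply, ← Fin.sum_univ_eq_sum_range
      (fun i => inner ℝ (b (φ i)) w • b (φ i))] using this
  refine tendsto_order.2 ⟨fun r hr => ?_, fun r hr => Eventually.of_forall fun l =>
    (singularValue_leadingMinor_le F e f l le_top).trans_lt hr⟩
  -- Otherwise the corners have singular value at most `r` for infinitely many `l`. Passing to the
  -- limit along these `l` in the projection bound makes `r` a bound for `F`, below its norm. No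
  -- monotonicity in `l` is needed.
  by_contra hcon
  refine hr.not_ge (bilinNorm_le F ?_ fun u v => ?_)
  · obtain ⟨l, hl⟩ := (not_eventually.1 hcon).exists
    exact (singularValue_nonneg _ _).trans (not_lt.1 hl)
  · have hF : Tendsto (fun l : ℕ => |F (∑ i : Fin l, inner ℝ (e (φ i)) u • e (φ i))
        (∑ j : Fin l, inner ℝ (f (φ j)) v • f (φ j))|) atTop (𝓝 |F u v|) :=
      (((continuous_apply_apply (E := 𝓛) F).tendsto (u, v)).comp
        ((expand e u).prodMk_nhds (expand f v))).abs
    refine le_of_tendsto_of_frequently hF ((not_eventually.1 hcon).mono fun l hl => ?_)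
    refine (abs_apply_projection_le (E := 𝓛) F (orthonormal_leading e l le_top)
      (orthonormal_leading f l le_top)
      (M := leadingMinor (matrixRep F e f) l le_top) (fun _ _ => rfl) u v).trans ?_
    gcongr
    exact not_lt.1 hl

theorem sigma_zero_eq_bilinNorm (F : 𝓛 →L[ℝ] 𝓛 →L[ℝ] ℝ) {L : ℕ∞}
    (e f : HilbertBasis (BasisIndex L) ℝ 𝓛) : sigma (matrixRep F e f) 0 = bilinNorm F := by
  unfold sigma
  split_ifs with h
  · subst h
    exact (tendsto_singularValue_leadingMinor F e f).limUnder_eq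
  · exact singularValue_leadingMinor_eq_norm F e f _ _ (ENat.natCast_toNat h).ge

end Sigma

end DistributedControl

namespace DistributedControl

/-! ### The cost of a single block -/

section Costs

variable {𝓛 : Submodule ℝ ControlSpace}

theorem energy_eq_norm_sq (w : ControlSpace) : energy w = ‖w‖ ^ 2 := by
  rw [← real_inner_self_eq_norm_sq, L2.inner_def, energy]
  simp [sq]

theorem energy_nonneg (w : ControlSpace) : 0 ≤ energy w := by
  rw [energy_eq_norm_sq]; positivity

theorem protocolCost_nonneg {m n : ℕ} (u : Fin m → 𝓛) (v : Fin n → 𝓛) :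
    0 ≤ protocolCost u v :=
  add_nonneg (mul_nonneg (by positivity) (Finset.sum_nonneg fun _ _ => energy_nonneg _))
    (mul_nonneg (by positivity) (Finset.sum_nonneg fun _ _ => energy_nonneg _))

theorem protocolCost_eq {m n : ℕ} (hm : m ≠ 0) (hn : n ≠ 0) (u : Fin m → 𝓛) (v : Fin n → 𝓛) :
    (m : ℝ) * n * protocolCost u v = ∑ i, ∑ j, (‖u i‖ ^ 2 + ‖v j‖ ^ 2) := by
  have hm' : (m : ℝ) ≠ 0 := Nat.cast_ne_zero.2 hm
  have hn' : (n : ℝ) ≠ 0 := Nat.cast_ne_zero.2 hn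
  simp only [protocolCost, energy_eq_norm_sq, Finset.sum_add_distrib, Finset.sum_const,
    Finset.card_univ, Fintype.card_fin, nsmul_eq_mul, ← Finset.mul_sum, Submodule.coe_norm]
  field_simp

theorem two_mul_abs_apply_le (F : 𝓛 →L[ℝ] 𝓛 →L[ℝ] ℝ) (u v : 𝓛) :
    2 * |F u v| ≤ bilinNorm F * (‖u‖ ^ 2 + ‖v‖ ^ 2) := by
  have h := abs_apply_le F u v
  nlinarith [mul_nonneg (bilinNorm_nonneg F) (sq_nonneg (‖u‖ - ‖v‖))]

theorem le_mul_protocolCost {F : 𝓛 →L[ℝ] 𝓛 →L[ℝ] ℝ} (hF : F ≠ 0) {m n : ℕ}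
    {H : Matrix (Fin m) (Fin n) ℝ} {u : Fin m → 𝓛} {v : Fin n → 𝓛} (h : Realizes F H u v) :
    2 / bilinNorm F * ∑ i, ∑ j, |H i j| ≤ (m : ℝ) * n * protocolCost u v := by
  rcases eq_or_ne m 0 with rfl | hm
  · simp
  rcases eq_or_ne n 0 with rfl | hn
  · simp
  rw [protocolCost_eq hm hn, Finset.mul_sum]
  refine Finset.sum_le_sum fun i _ => ?_
  rw [Finset.mul_sum]
  refine Finset.sum_le_sum fun j _ => ?_
  rw [← h i j, div_mul_eq_mul_div, div_le_iff₀ (bilinNorm_pos hF), mul_comm _ (bilinNorm F)]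
  exact two_mul_abs_apply_le F _ _

theorem ofReal_le_mul_infCost {F : 𝓛 →L[ℝ] 𝓛 →L[ℝ] ℝ} (hF : F ≠ 0) {m n : ℕ}
    (H : Matrix (Fin m) (Fin n) ℝ) :
    ENNReal.ofReal (2 / bilinNorm F * ∑ i, ∑ j, |H i j|) ≤ (m : ℝ≥0∞) * n * infCost F H := by
  rcases eq_or_ne m 0 with rfl | hm
  · simp
  rcases eq_or_ne n 0 with rfl | hn
  · simp
  have h0 : (m : ℝ≥0∞) * n ≠ 0 := by simp [hm, hn]
  have htop : (m : ℝ≥0∞) * n ≠ ⊤ := by finiteness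
  rw [mul_comm (m * n : ℝ≥0∞), ← ENNReal.div_le_iff h0 htop]
  refine le_iInf fun u => le_iInf fun v => le_iInf fun h => ?_
  rw [ENNReal.div_le_iff h0 htop, mul_comm (ENNReal.ofReal _), ← ENNReal.ofReal_natCast, ← ENNReal.ofReal_natCast,
    ← ENNReal.ofReal_mul (by positivity), ← ENNReal.ofReal_mul (by positivity)]
  exact ENNReal.ofReal_le_ofReal (le_mul_protocolCost hF h)

/-- Sharpness of the AM-GM bound for one entry, up to `ε`. -/
theorem exists_apply_eq_norm_sq_add_le {F : 𝓛 →L[ℝ] 𝓛 →L[ℝ] ℝ} (hF : F ≠ 0) (c : ℝ) {ε : ℝ}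
    (hε : 0 < ε) : ∃ u v, F u v = c ∧ ‖u‖ ^ 2 + ‖v‖ ^ 2 ≤ 2 / bilinNorm F * |c| + ε := by
  have hF0 : 0 < bilinNorm F := bilinNorm_pos hF
  rcases eq_or_ne c 0 with rfl | hc
  · exact ⟨0, 0, by simp, by simpa using hε.le⟩
  have hc0 : 0 < |c| := abs_pos.2 hc
  -- any pair of nonzero vectors can be balanced so that `F u v = c`
  set B := 2 / bilinNorm F * |c| + ε with hB
  have hB0 : 0 < B := by positivity
  -- Being below the norm, `2 |c| / B` fails as a bound for `F`; a pair violating it costs less than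
  -- `B` once balanced.
  have hlt : 2 * |c| / B < bilinNorm F := by
    rw [div_lt_iff₀ hB0, hB, mul_add]
    have : bilinNorm F * (2 / bilinNorm F * |c|) = 2 * |c| := by field_simp
    rw [this]
    linarith [mul_pos hF0 hε]
  obtain ⟨u, v, huv⟩ : ∃ u v, 2 * |c| / B * ‖u‖ * ‖v‖ < |F u v| := by
    by_contra! hcon
    exact hlt.not_ge (bilinNorm_le F (by positivity) hcon)
  have hFuv : 0 < |F u v| := lt_of_le_of_lt (by positivity) huv
  have hne : F u v ≠ 0 := abs_pos.1 hFuv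
  have hu : 0 < ‖u‖ := norm_pos_iff.2 (by rintro rfl; simp at hne)
  have hv : 0 < ‖v‖ := norm_pos_iff.2 (by rintro rfl; simp at hne)
  -- This `r` gives the two rescaled vectors the same squared norm `|c| ‖u‖ ‖v‖ / |F u v|`, the
  -- equality case of AM-GM.
  set r := |c| * ‖v‖ / (|F u v| * ‖u‖) with hr
  have hr0 : 0 < r := by positivity
  have hs : √r ≠ 0 := (Real.sqrt_pos.2 hr0).ne'
  refine ⟨√r • u, (c / (F u v * √r)) • v, ?_, ?_⟩
  · simp only [map_smul, smul_apply, smul_eq_mul]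
    field_simp
  · have e1 : ‖√r • u‖ ^ 2 = |c| * ‖u‖ * ‖v‖ / |F u v| := by
      rw [norm_smul, mul_pow, Real.norm_eq_abs, sq_abs, Real.sq_sqrt hr0.le, hr]
      field_simp
    have e2 : ‖(c / (F u v * √r)) • v‖ ^ 2 = |c| * ‖u‖ * ‖v‖ / |F u v| := by
      rw [norm_smul, mul_pow, Real.norm_eq_abs, abs_div, abs_mul, div_pow, mul_pow, sq_abs √r,
        Real.sq_sqrt hr0.le, hr]
      field_simp
    rw [e1, e2, ← add_div, div_le_iff₀ hFuv]
    have h3 : 2 * |c| / B * ‖u‖ * ‖v‖ = 2 * |c| * ‖u‖ * ‖v‖ / B := by ring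
    rw [h3, div_lt_iff₀ hB0] at huv
    linarith

theorem IsMonochromatic.exists_realizes {F : 𝓛 →L[ℝ] 𝓛 →L[ℝ] ℝ} (hF : F ≠ 0) {m n : ℕ}
    {H : Matrix (Fin m) (Fin n) ℝ} (hH : IsMonochromatic H) {ε : ℝ} (hε : 0 < ε) :
    ∃ (u : Fin m → 𝓛) (v : Fin n → 𝓛), Realizes F H u v ∧
      (m : ℝ) * n * protocolCost u v ≤ 2 / bilinNorm F * ∑ i, ∑ j, |H i j| + ε := by
  rcases eq_or_ne m 0 with rfl | hm
  · exact ⟨0, 0, fun i => i.elim0, by simpa using hε.le⟩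
  rcases eq_or_ne n 0 with rfl | hn
  · exact ⟨0, 0, fun _ j => j.elim0, by simpa using hε.le⟩
  have hm' : (0 : ℝ) < m := Nat.cast_pos.2 (Nat.pos_of_ne_zero hm)
  have hn' : (0 : ℝ) < n := Nat.cast_pos.2 (Nat.pos_of_ne_zero hn)
  let i₀ : Fin m := ⟨0, Nat.pos_of_ne_zero hm⟩
  let j₀ : Fin n := ⟨0, Nat.pos_of_ne_zero hn⟩
  have hconst (i j) : H i j = H i₀ j₀ := hH i j i₀ j₀
  -- The same pair is charged once for each of the `m n` entries, so the tolerance is divided by `m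
  -- n`.
  obtain ⟨u, v, huv, hle⟩ := exists_apply_eq_norm_sq_add_le hF (H i₀ j₀)
    (ε := ε / (m * n)) (by positivity)
  refine ⟨fun _ => u, fun _ => v, fun i j => huv.trans (hconst i j).symm, ?_⟩
  rw [protocolCost_eq hm hn]
  simp only [hconst, Finset.sum_const, Finset.card_univ, Fintype.card_fin, nsmul_eq_mul]
  calc (m : ℝ) * (n * (‖u‖ ^ 2 + ‖v‖ ^ 2))
      ≤ m * (n * (2 / bilinNorm F * |H i₀ j₀| + ε / (m * n))) := by gcongr
    _ = _ := by field_simp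

/-- The positions inside the blocks biject with those of the matrix: `covers` gives surjectivity,
and `disjoint` with the injectivity of `t` and `s` gives injectivity. -/
theorem SubmatrixPartition.sum_eq {m n K : ℕ} (P : SubmatrixPartition m n K)
    (g : Fin m → Fin n → ℝ) :
    ∑ k, ∑ a, ∑ b, g (P.t k a) (P.s k b) = ∑ i, ∑ j, g i j := by
  let φ : (Σ k, Fin (P.rows k) × Fin (P.cols k)) → Fin m × Fin n :=
    fun x => (P.t x.1 x.2.1, P.s x.1 x.2.2)
  have hφ : Function.Bijective φ := by
    constructor
    · rintro ⟨k, a, b⟩ ⟨k', a', b'⟩ h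
      obtain ⟨h1, h2⟩ := Prod.mk.inj h
      obtain rfl := P.disjoint k k' a b a' b' h1 h2
      obtain rfl := (P.t k).injective h1
      obtain rfl := (P.s k).injective h2
      rfl
    · rintro ⟨i, j⟩
      obtain ⟨k, a, b, rfl, rfl⟩ := P.covers i j
      exact ⟨⟨k, a, b⟩, rfl⟩
  rw [← Fintype.sum_prod_type' g, ← hφ.sum_comp fun x : Fin m × Fin n => g x.1 x.2,
    Fintype.sum_sigma]
  exact Finset.sum_congr rfl fun k _ => (Fintype.sum_prod_type' _).symm

theorem SubmatrixPartition.sum_block {m n K : ℕ} (P : SubmatrixPartition m n K)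
    (H : Matrix (Fin m) (Fin n) ℝ) (C : ℝ) :
    ∑ k, C * ∑ a, ∑ b, |P.block H k a b| = C * ∑ i, ∑ j, |H i j| := by
  rw [← Finset.mul_sum, ← P.sum_eq fun i j => |H i j|]
  rfl

end Costs

/-! ### Averaging over a partition -/

section Averages

variable {𝓛 : Submodule ℝ ControlSpace} {F : 𝓛 →L[ℝ] 𝓛 →L[ℝ] ℝ} {m n K : ℕ}

theorem ofReal_le_averagedCost (hF : F ≠ 0) (hm : 0 < m) (hn : 0 < n)
    (H : Matrix (Fin m) (Fin n) ℝ) (P : SubmatrixPartition m n K) :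
    ENNReal.ofReal (2 / (m * n * bilinNorm F) * ∑ i, ∑ j, |H i j|) ≤ averagedCost F H P := by
  have hmn : (0 : ℝ) < m * n := by positivity
  have hF0 := bilinNorm_pos hF
  have h : 2 / (m * n * bilinNorm F) * ∑ i, ∑ j, |H i j|
      = (m * n : ℝ)⁻¹ * ∑ k, 2 / bilinNorm F * ∑ a, ∑ b, |P.block H k a b| := by
    rw [P.sum_block, div_mul_eq_div_div_swap]; ring
  rw [h, ENNReal.ofReal_mul (by positivity), ENNReal.ofReal_sum_of_nonneg
    fun k _ => by positivity, ENNReal.ofReal_inv_of_pos hmn, ENNReal.ofReal_mul (by positivity),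
    ENNReal.ofReal_natCast, ENNReal.ofReal_natCast, averagedCost]
  gcongr with k
  exact ofReal_le_mul_infCost hF _

theorem averagedCost_le_of_mem_attainableAverages (hm : 0 < m) (hn : 0 < n)
    {H : Matrix (Fin m) (Fin n) ℝ} {P : SubmatrixPartition m n K} {x : ℝ}
    (hx : x ∈ attainableAverages F H P) : averagedCost F H P ≤ ENNReal.ofReal x := by
  obtain ⟨u, v, huv, rfl⟩ := hx
  have hmn : (0 : ℝ) < m * n := by positivity
  rw [one_div, ENNReal.ofReal_mul (by positivity), ENNReal.ofReal_sum_of_nonneg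
    fun k _ => mul_nonneg (by positivity) (protocolCost_nonneg _ _),
    ENNReal.ofReal_inv_of_pos hmn, ENNReal.ofReal_mul (by positivity),
    ENNReal.ofReal_natCast, ENNReal.ofReal_natCast, averagedCost]
  gcongr with k
  rw [ENNReal.ofReal_mul (by positivity), ENNReal.ofReal_mul (by positivity),
    ENNReal.ofReal_natCast, ENNReal.ofReal_natCast]
  gcongr
  exact iInf_le_of_le (u k) (iInf_le_of_le (v k) (iInf_le _ (huv k)))

theorem isGLB_attainableAverages (hF : F ≠ 0) (hm : 0 < m) (hn : 0 < n)
    {H : Matrix (Fin m) (Fin n) ℝ} {P : SubmatrixPartition m n K}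
    (hH : ∀ k, IsMonochromatic (P.block H k)) :
    IsGLB (attainableAverages F H P) (2 / (m * n * bilinNorm F) * ∑ i, ∑ j, |H i j|) := by
  have hmn : (0 : ℝ) < m * n := by positivity
  have hF0 := bilinNorm_pos hF
  have hJ : 2 / (m * n * bilinNorm F) * ∑ i, ∑ j, |H i j|
      = 1 / (m * n : ℝ) * ∑ k, 2 / bilinNorm F * ∑ a, ∑ b, |P.block H k a b| := by
    rw [P.sum_block, div_mul_eq_div_div_swap]; ring
  rw [hJ]
  constructor
  · rintro _ ⟨u, v, huv, rfl⟩
    refine mul_le_mul_of_nonneg_left (Finset.sum_le_sum fun k _ => ?_) (by positivity)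
    exact le_mul_protocolCost hF (huv k)
  · intro x hx
    refine le_of_forall_pos_le_add fun ε hε => ?_
    -- Spending this on each of `K` blocks and dividing by `m n` loses `ε K / (K + 1) ≤ ε`; `K + 1`
    -- avoids a separate case `K = 0`.
    have hδ : 0 < ε * (m * n) / (K + 1) := by positivity
    choose u v huv hle using fun k => (hH k).exists_realizes hF hδ
    refine (hx ⟨u, v, huv, rfl⟩).trans ?_
    calc 1 / (m * n : ℝ) * ∑ k, (P.rows k : ℝ) * P.cols k * protocolCost (u k) (v k)
        ≤ 1 / (m * n : ℝ) * ∑ k, (2 / bilinNorm F * ∑ a, ∑ b, |P.block H k a b|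
            + ε * (m * n) / (K + 1)) := by
          gcongr with k
          exact hle k
      _ = 1 / (m * n : ℝ) * ∑ k, 2 / bilinNorm F * ∑ a, ∑ b, |P.block H k a b| + ε * (K / (K + 1)) := by
          rw [Finset.sum_add_distrib, mul_add]
          congr 1
          simp only [Finset.sum_const, Finset.card_univ, Fintype.card_fin, nsmul_eq_mul]
          field_simp
      _ ≤ _ := by
          gcongr
          refine mul_le_of_le_one_right hε.le ((div_le_one (by positivity)).2 (by linarith))

/-- The averaged cost lies below every attainable average, hence below their infimum, which is the
general lower bound. -/
theorem averagedCost_eq_of_isMonochromatic (hF : F ≠ 0) (hm : 0 < m) (hn : 0 < n)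
    {H : Matrix (Fin m) (Fin n) ℝ} {P : SubmatrixPartition m n K}
    (hH : ∀ k, IsMonochromatic (P.block H k)) :
    averagedCost F H P = ENNReal.ofReal (2 / (m * n * bilinNorm F) * ∑ i, ∑ j, |H i j|) := by
  have hF0 := bilinNorm_pos hF
  have hglb := isGLB_attainableAverages hF hm hn hH
  have hJ : 0 ≤ 2 / (m * n * bilinNorm F) * ∑ i, ∑ j, |H i j| := by positivity
  -- In `ℝ` the empty set has no greatest lower bound. An attainable average therefore exists, so
  -- the averaged cost is finite and can be compared in `ℝ`.
  obtain ⟨x, hx⟩ := hglb.nonempty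
  have htop : averagedCost F H P ≠ ⊤ :=
    ((averagedCost_le_of_mem_attainableAverages hm hn hx).trans_lt ENNReal.ofReal_lt_top).ne
  refine le_antisymm ?_ (ofReal_le_averagedCost hF hm hn H P)
  rw [← ENNReal.ofReal_toReal htop]
  refine ENNReal.ofReal_le_ofReal (hglb.2 fun y hy => ?_)
  exact ENNReal.toReal_le_of_le_ofReal (hJ.trans (hglb.1 hy))
    (averagedCost_le_of_mem_attainableAverages hm hn hy)

end Averages

end DistributedControl

theorem theorem7p1
    (𝓛 : Submodule ℝ DistributedControl.ControlSpace)
    (h𝓛 : IsClosed (𝓛 : Set DistributedControl.ControlSpace))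
    (F : 𝓛 →L[ℝ] 𝓛 →L[ℝ] ℝ) (hF : F ≠ 0)
    {L : ℕ∞} (e f : HilbertBasis (DistributedControl.BasisIndex L) ℝ 𝓛)
    (hreg : DistributedControl.IsRegular (DistributedControl.matrixRep F e f))
    {m n K : ℕ} (hm : 0 < m) (hn : 0 < n) (H : Matrix (Fin m) (Fin n) ℝ)
    (P : DistributedControl.SubmatrixPartition m n K) :
    let σ₁ : ℝ := DistributedControl.sigma (DistributedControl.matrixRep F e f) 0
    let J : ℝ := 2 / (m * n * σ₁) * ∑ i, ∑ j, |H i j|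
    ENNReal.ofReal J ≤ DistributedControl.averagedCost F H P ∧
      ((∀ k, DistributedControl.IsMonochromatic (P.block H k)) →
        DistributedControl.averagedCost F H P = ENNReal.ofReal J ∧
          IsGLB (DistributedControl.attainableAverages F H P) J) := by
  simp only [DistributedControl.sigma_zero_eq_bilinNorm]
  exact ⟨DistributedControl.ofReal_le_averagedCost hF hm hn H P, fun hH =>
    ⟨DistributedControl.averagedCost_eq_of_isMonochromatic hF hm hn hH,
      DistributedControl.isGLB_attainableAverages hF hm hn hH⟩⟩
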